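/- Let $M$ be a compact connected $C^1$-smooth manifold (finite-dimensional, without boundary) with a continuous Riemannian metric, let $|\cdot|_x$ be the Riemannian norm on $T_xM$ and $d$ the geodesic distance. Let $V$ be a vector field on $M$ of class $C^1$ (around every point its components in a chart are $C^1$ functions), and let $\varphi_V:\mathbb R\times M\to M$ be the flow of $\dot x=V(x)$. A point $x_0\in M$ is called minimal if the closure of its orbit $\{\varphi_V(t,x_0):t\in\mathbb R\}$ contains no proper nonempty closed $\varphi_V$-invariant subset. Let $\mathrm{Min}_V$ be the closure of the set of all minimal points, and for $\varepsilon>0$ let $(\mathrm{Min}_V)_\varepsilon=\{x\in M:\exists\, y\in \mathrm{Min}_V,\ d(x,y)<\varepsilon\}$. For $\delta>0$ and $a<b$, a $\delta$-solution of $\dot x=V(x)$ on $[a,b]$ is a continuous, piecewise $C^1$ curve $x:[a,b]\to M$ such that $|\dot x(t)-V(x(t))|_{x(t)}\le\delta$ for every $t\in[a,b]$ at which the derivative $\dot x(t)$ (one-sided at $a$ and $b$) exists. Then for every $\varepsilon>0$ there exist $\delta>0$ and $T>0$ such that every $\delta$-solution $x:[0,T]\to M$ of $\dot x=V(x)$ satisfies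 $$\{x(t):t\in[0,T]\}\cap(\mathrm{Min}_V)_\varepsilon\neq\emptyset .$$ -/

import Mathlib

open Set Filter Topology Manifold Bundle
open scoped ContDiff

section GlobalFlow

variable {E : Type*} [NormedAddCommGroup E] [NormedSpace ℝ E] [CompleteSpace E]
  {H : Type*} [TopologicalSpace H] {I : ModelWithCorners ℝ E H}
  {M : Type*} [TopologicalSpace M] [ChartedSpace H M] [IsManifold I 1 M]
  [BoundarylessManifold I M] {V : (x : M) → TangentSpace I x}

/-- Locally, the integral curves of a `C¹` vector field exist on a uniform time interval. -/
theorem exists_uniform_isMIntegralCurveOn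
    (hV : ContMDiff I I.tangent 1 (fun x ↦ (⟨x, V x⟩ : TangentBundle I M))) (x₀ : M) :
    ∃ U ∈ 𝓝 x₀, ∃ ε > (0 : ℝ), ∀ x ∈ U,
      ∃ γ : ℝ → M, γ 0 = x ∧ IsMIntegralCurveOn γ V (Ioo (-ε) ε) := by
  have hx : I.IsInteriorPoint x₀ := BoundarylessManifold.isInteriorPoint
  have hv := hV.contMDiffAt (x := x₀)
  rw [contMDiffAt_iff] at hv
  obtain ⟨_, hv⟩ := hv
  obtain ⟨ε, hε, a, r, L, K, hr, hpl⟩ := IsPicardLindelof.of_contDiffAt_one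
    (hv.contDiffAt (range_mem_nhds_isInteriorPoint hx)).snd
  obtain ⟨α, hα, hαc⟩ :=
    (hpl 0).exists_forall_mem_closedBall_eq_hasDerivWithinAt_continuousOn
  set y₀ := extChartAt I x₀ x₀ with hy₀
  have hr' : (0 : ℝ) < r := by exact_mod_cast hr
  have hα0 : α (y₀, 0) = y₀ := (hα y₀ (Metric.mem_closedBall_self hr'.le)).1
  have hdom : Metric.closedBall y₀ r ×ˢ Icc ((0 : ℝ) - ε) (0 + ε) ∈ 𝓝 (y₀, (0 : ℝ)) :=
    prod_mem_nhds (Metric.closedBall_mem_nhds _ hr') (Icc_mem_nhds (by linarith) (by linarith))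
  have hcont : ContinuousAt α (y₀, 0) := hαc.continuousAt hdom
  have hW : α ⁻¹' (interior (extChartAt I x₀).target) ∈ 𝓝 (y₀, (0 : ℝ)) := by
    apply hcont.preimage_mem_nhds
    rw [hα0]
    exact isOpen_interior.mem_nhds ((I.isInteriorPoint_iff).mp hx)
  obtain ⟨A, hA, B, hB, hAB⟩ := mem_nhds_prod_iff.mp (inter_mem hdom hW)
  obtain ⟨η, hη, hηB⟩ := Metric.mem_nhds_iff.mp hB
  rw [Real.ball_eq_Ioo, zero_sub, zero_add] at hηB
  refine ⟨(extChartAt I x₀).source ∩ (extChartAt I x₀) ⁻¹' A,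
    inter_mem (extChartAt_source_mem_nhds x₀)
      ((continuousAt_extChartAt x₀).preimage_mem_nhds hA), min η ε, lt_min hη hε, ?_⟩
  rintro x ⟨hxs, hxA⟩
  set y := extChartAt I x₀ x with hy
  have h0B : (0 : ℝ) ∈ B := mem_of_mem_nhds hB
  have hyr : y ∈ Metric.closedBall y₀ r := (hAB (mk_mem_prod hxA h0B)).1.1
  refine ⟨(extChartAt I x₀).symm ∘ (fun t ↦ α (y, t)), ?_, ?_⟩
  · simp only [Function.comp_apply]
    rw [(hα y hyr).1, hy, PartialEquiv.left_inv _ hxs]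
  intro t ht
  have htη : t ∈ Ioo (-η) η :=
    ⟨by linarith [ht.1, min_le_left η ε], by linarith [ht.2, min_le_left η ε]⟩
  have htε : t ∈ Ioo (0 - ε) (0 + ε) :=
    ⟨by linarith [ht.1, min_le_right η ε], by linarith [ht.2, min_le_right η ε]⟩
  have hder := ((hα y hyr).2 t (Ioo_subset_Icc_self htε)).hasDerivAt (Icc_mem_nhds htε.1 htε.2)
  set f : ℝ → E := fun t ↦ α (y, t) with hf
  let xₜ : M := (extChartAt I x₀).symm (f t)
  have h : HasDerivAt f (x := t) <| fderivWithin ℝ (extChartAt I x₀ ∘ (extChartAt I xₜ).symm)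
    (range I) (extChartAt I xₜ xₜ) (V xₜ) := hder
  rw [← tangentCoordChange_def] at h
  have hf3 : f t ∈ interior (extChartAt I x₀).target := (hAB (mk_mem_prod hxA (hηB htη))).2
  have hf3' := mem_of_mem_of_subset hf3 interior_subset
  have hft1 := mem_preimage.mp <|
    mem_of_mem_of_subset hf3' (extChartAt I x₀).target_subset_preimage_source
  have hft2 := mem_extChartAt_source (I := I) xₜ
  have hchart : ∀ w : E, HasDerivAt f (tangentCoordChange I xₜ x₀ xₜ w) t →
      HasDerivAt ((extChartAt I xₜ ∘ (extChartAt I x₀).symm) ∘ f) w t := by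
    intro w hw
    rw [← tangentCoordChange_self (I := I) (x := xₜ) (z := xₜ) (v := w) hft2,
      ← tangentCoordChange_comp (x := x₀) ⟨⟨hft2, hft1⟩, hft2⟩]
    apply HasFDerivAt.comp_hasDerivAt _ _ hw
    apply HasFDerivWithinAt.hasFDerivAt (s := range I) _ <|
      mem_nhds_iff.mpr ⟨interior (extChartAt I x₀).target,
        subset_trans interior_subset (extChartAt_target_subset_range ..),
        isOpen_interior, hf3⟩
    rw [← (extChartAt I x₀).right_inv hf3']
    exact hasFDerivWithinAt_tangentCoordChange ⟨hft1, hft2⟩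
  apply HasMFDerivAt.hasMFDerivWithinAt
  refine ⟨(continuousAt_extChartAt_symm'' hf3').comp h.continuousAt, ?_⟩
  have hF := (hchart _ h).hasFDerivAt.hasFDerivWithinAt (s := range 𝓘(ℝ, ℝ))
  exact hF

/-- On a compact manifold without boundary, a `C¹` vector field is complete. -/
theorem exists_global_isMIntegralCurve [T2Space M] [CompactSpace M]
    (hV : ContMDiff I I.tangent 1 (fun x ↦ (⟨x, V x⟩ : TangentBundle I M))) (x : M) :
    ∃ γ : ℝ → M, γ 0 = x ∧ IsMIntegralCurve γ V := by
  have key : ∃ ε > (0 : ℝ), ∀ x ∈ (univ : Set M),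
      ∃ γ : ℝ → M, γ 0 = x ∧ IsMIntegralCurveOn γ V (Ioo (-ε) ε) := by
    refine isCompact_univ.induction_on (p := fun s : Set M ↦ ∃ ε > (0 : ℝ), ∀ x ∈ s,
      ∃ γ : ℝ → M, γ 0 = x ∧ IsMIntegralCurveOn γ V (Ioo (-ε) ε)) ?_ ?_ ?_ ?_
    · exact ⟨1, one_pos, fun x hx ↦ hx.elim⟩
    · rintro s t hst ⟨ε, hε, h⟩
      exact ⟨ε, hε, fun x hx ↦ h x (hst hx)⟩
    · rintro s t ⟨ε, hε, h⟩ ⟨ε', hε', h'⟩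
      refine ⟨min ε ε', lt_min hε hε', fun x hx ↦ ?_⟩
      rcases hx with hx | hx
      · obtain ⟨γ, h0, hγ⟩ := h x hx
        exact ⟨γ, h0, hγ.mono (Ioo_subset_Ioo (neg_le_neg (min_le_left _ _)) (min_le_left _ _))⟩
      · obtain ⟨γ, h0, hγ⟩ := h' x hx
        exact ⟨γ, h0, hγ.mono (Ioo_subset_Ioo (neg_le_neg (min_le_right _ _)) (min_le_right _ _))⟩
    · intro x _
      obtain ⟨U, hU, ε, hε, h⟩ := exists_uniform_isMIntegralCurveOn hV x
      exact ⟨U, mem_nhdsWithin_of_mem_nhds hU, ε, hε, h⟩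
  obtain ⟨ε, hε, h⟩ := key
  exact exists_isMIntegralCurve_of_isMIntegralCurveOn hV hε (fun x ↦ h x (mem_univ x)) x

/-- The flow `φ_V` of a `C¹` vector field on a compact manifold: `t ↦ flowOf hV t x` is the
(unique) solution of `ẋ = V(x)`, defined for all times, that starts at `x`. -/
noncomputable def flowOf [T2Space M] [CompactSpace M]
    (hV : ContMDiff I I.tangent 1 (fun x ↦ (⟨x, V x⟩ : TangentBundle I M)))
    (t : ℝ) (x : M) : M :=
  Classical.choose (exists_global_isMIntegralCurve hV x) t

theorem flowOf_zero [T2Space M] [CompactSpace M]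
    (hV : ContMDiff I I.tangent 1 (fun x ↦ (⟨x, V x⟩ : TangentBundle I M))) (x : M) :
    flowOf hV 0 x = x :=
  (Classical.choose_spec (exists_global_isMIntegralCurve hV x)).1

theorem isMIntegralCurve_flowOf [T2Space M] [CompactSpace M]
    (hV : ContMDiff I I.tangent 1 (fun x ↦ (⟨x, V x⟩ : TangentBundle I M))) (x : M) :
    IsMIntegralCurve (fun t ↦ flowOf hV t x) V :=
  (Classical.choose_spec (exists_global_isMIntegralCurve hV x)).2

theorem eq_flowOf [T2Space M] [CompactSpace M]
    (hV : ContMDiff I I.tangent 1 (fun x ↦ (⟨x, V x⟩ : TangentBundle I M)))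
    {γ : ℝ → M} (hγ : IsMIntegralCurve γ V) (t : ℝ) : γ t = flowOf hV t (γ 0) :=
  congrFun (isMIntegralCurve_Ioo_eq_of_contMDiff_boundaryless (t₀ := 0) hV hγ
    (isMIntegralCurve_flowOf hV (γ 0)) (flowOf_zero hV (γ 0)).symm) t

end GlobalFlow

section MinimalPoints

variable {X : Type*} [TopologicalSpace X]

/-- The closure of the orbit of `x` under `φ`. -/
def orbitClosure (φ : ℝ → X → X) (x : X) : Set X :=
  closure (range fun t ↦ φ t x)

/-- `x` is minimal for `φ`: the closure of its orbit contains no proper (nonempty) closed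
invariant subset. -/
def IsMinimalPoint (φ : ℝ → X → X) (x : X) : Prop :=
  ∀ A : Set X, A ⊆ orbitClosure φ x → A.Nonempty → IsClosed A → IsInvariant φ A →
    A = orbitClosure φ x

/-- The closure of the set of all minimal points of `φ`. -/
def minimalSet (φ : ℝ → X → X) : Set X :=
  closure {x | IsMinimalPoint φ x}

end MinimalPoints

section DeltaSolutions

variable {E : Type*} [NormedAddCommGroup E] [NormedSpace ℝ E]
  {H : Type*} [TopologicalSpace H] (I : ModelWithCorners ℝ E H)
  {M : Type*} [TopologicalSpace M] [ChartedSpace H M]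

/-- `γ` is continuous on `[a, b]`, and `[a, b]` can be divided into finitely many closed
subintervals on each of which `γ` is of class `C¹`, up to the end points. -/
def IsPiecewiseC1On (γ : ℝ → M) (a b : ℝ) : Prop :=
  ContinuousOn γ (Icc a b) ∧
    ∃ (n : ℕ) (τ : ℕ → ℝ), Monotone τ ∧ τ 0 = a ∧ τ n = b ∧
      ∀ i < n, ContMDiffOn 𝓘(ℝ, ℝ) I 1 γ (Icc (τ i) (τ (i + 1)))

variable {I} [RiemannianBundle (fun x : M ↦ TangentSpace I x)]

/-- `γ : [a, b] → M` is a `δ`-solution of `ẋ = V(x)`: it is piecewise `C¹`, and at every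
`t ∈ [a, b]` where the derivative exists (one-sided at `a` and `b`) it satisfies
`|γ'(t) - V(γ(t))| ≤ δ` in the Riemannian norm. Only the values of `γ` on `[a, b]` matter. -/
def IsDeltaSolution (V : (x : M) → TangentSpace I x) (δ a b : ℝ) (γ : ℝ → M) : Prop :=
  a < b ∧ IsPiecewiseC1On I γ a b ∧
    ∀ t ∈ Icc a b, MDifferentiableWithinAt 𝓘(ℝ, ℝ) I γ (Icc a b) t →
      ‖(mfderivWithin 𝓘(ℝ, ℝ) I γ (Icc a b) t (1 : ℝ) : TangentSpace I (γ t)) - V (γ t)‖ ≤ δ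

end DeltaSolutions

/- Every orbit enters a given open neighbourhood `U` of the minimal set in finite time, because its
`ω`-limit set is nonempty, closed and invariant and therefore contains a minimal point. In a chart,
Grönwall's inequality shows that `δ`-solutions starting near `y` stay close to the orbit of `y` over
short times, and by compactness the length of time is uniform in `y`; iterating, `δ`-solutions
shadow orbits over every bounded time. So all `δ`-solutions starting near `y` enter `U` with the
orbit of `y`, and compactness makes `δ` and the time uniform in `y`. -/

section MeanValue

open MeasureTheory

variable {E : Type*} [NormedAddCommGroup E] [NormedSpace ℝ E] [CompleteSpace E]
  {f : ℝ → E} {a b : ℝ} {s : Set ℝ}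

theorem norm_sub_le_integral_of_norm_deriv_le_off_countable {B : ℝ → ℝ} (hab : a ≤ b)
    (hs : s.Countable) (hf : ContinuousOn f (Icc a b))
    (hf' : ∀ t ∈ Ioo a b \ s, ∃ D, HasDerivAt f D t ∧ ‖D‖ ≤ B t)
    (hB : IntervalIntegrable B volume a b) : ‖f b - f a‖ ≤ ∫ t in a..b, B t := by
  have hderiv : ∀ t ∈ Ioo a b \ s, HasDerivAt f (deriv f t) t ∧ ‖deriv f t‖ ≤ B t := by
    intro t ht
    obtain ⟨D, hD, hDB⟩ := hf' t ht
    rw [hD.deriv]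
    exact ⟨hD, hDB⟩
  have hbound : ∀ᵐ t, t ∈ Ioc a b → ‖deriv f t‖ ≤ B t := by
    filter_upwards [measure_eq_zero_iff_ae_notMem.1 ((hs.insert b).measure_zero volume)]
      with t ht hat
    rw [mem_insert_iff, not_or] at ht
    exact (hderiv t ⟨⟨hat.1, hat.2.lt_of_ne ht.1⟩, ht.2⟩).2
  have hint : IntervalIntegrable (deriv f) volume a b := by
    refine hB.mono_fun' (aestronglyMeasurable_deriv f _) ?_
    rwa [uIoc_of_le hab, EventuallyLE, ae_restrict_iff' measurableSet_Ioc]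
  rw [← integral_eq_of_hasDerivAt_off_countable_of_le f (deriv f) hab hs hf
    (fun t ht ↦ (hderiv t ht).1) hint]
  exact intervalIntegral.norm_integral_le_of_norm_le hab hbound hB

theorem norm_le_gronwallBound_of_norm_deriv_le_off_countable {K ε : ℝ} (hK : 0 ≤ K)
    (hs : s.Countable) (hf : ContinuousOn f (Icc a b))
    (hf' : ∀ t ∈ Ioo a b \ s, ∃ D, HasDerivAt f D t ∧ ‖D‖ ≤ K * ‖f t‖ + ε)
    {t : ℝ} (ht : t ∈ Icc a b) : ‖f t‖ ≤ gronwallBound ‖f a‖ K ε (t - a) := by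
  let B : ℝ → ℝ := fun t ↦ K * ‖f t‖ + ε
  let h : ℝ → ℝ := fun t ↦ ‖f a‖ + ∫ u in a..t, B u
  have hB : ContinuousOn B (Icc a b) := (continuousOn_const.mul hf.norm).add continuousOn_const
  have hBint : ∀ t ∈ Icc a b, IntervalIntegrable B volume a t := fun t ht ↦
    (hB.mono (Icc_subset_Icc_right ht.2)).intervalIntegrable_of_Icc ht.1
  have hfh : ∀ t ∈ Icc a b, ‖f t‖ ≤ h t := by
    intro t ht
    have hsub : ‖f t - f a‖ ≤ ∫ u in a..t, B u :=
      norm_sub_le_integral_of_norm_deriv_le_off_countable ht.1 hs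
        (hf.mono (Icc_subset_Icc_right ht.2))
        (fun u hu ↦ hf' u ⟨Ioo_subset_Ioo_right ht.2 hu.1, hu.2⟩) (hBint t ht)
    linarith [norm_le_norm_sub_add (f t) (f a)]
  have hderiv : ∀ t ∈ Icc a b, HasDerivWithinAt h (B t) (Icc a b) t := by
    intro t ht
    have : Fact (t ∈ Icc a b) := ⟨ht⟩
    exact (intervalIntegral.integral_hasDerivWithinAt_right (hBint t ht)
      (hB.stronglyMeasurableAtFilter_nhdsWithin measurableSet_Icc t) (hB t ht)).const_add _
  refine (hfh t ht).trans (le_gronwallBound_of_liminf_deriv_right_le (f' := B)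
    (fun t ht ↦ (hderiv t ht).continuousWithinAt) (fun t ht r hr ↦ ?_) ?_ (fun t ht ↦ ?_) t ht)
  · exact ((hderiv t (Ico_subset_Icc_self ht)).mono_of_mem_nhdsWithin
      (Icc_mem_nhdsGE_of_mem ht)).liminf_right_slope_le hr
  · simp [h]
  · simp only [B]
    gcongr
    exact hfh t (Ico_subset_Icc_self ht)

theorem norm_sub_le_mul_of_norm_deriv_le_off_countable {C : ℝ} (hs : s.Countable)
    (hf : ContinuousOn f (Icc a b)) (hf' : ∀ t ∈ Ioo a b \ s, ∃ D, HasDerivAt f D t ∧ ‖D‖ ≤ C)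
    {t : ℝ} (ht : t ∈ Icc a b) : ‖f t - f a‖ ≤ C * (t - a) := by
  have hsub : ∀ t ∈ Ioo a b \ s, ∃ D, HasDerivAt (fun t ↦ f t - f a) D t ∧
      ‖D‖ ≤ 0 * ‖f t - f a‖ + C := by
    simpa only [zero_mul, zero_add, hasDerivAt_sub_const_iff] using hf'
  simpa [gronwallBound_K0] using norm_le_gronwallBound_of_norm_deriv_le_off_countable le_rfl hs
    (hf.sub continuousOn_const) hsub ht

end MeanValue

theorem continuous_gronwallBound (K x : ℝ) :
    Continuous fun p : ℝ × ℝ ↦ gronwallBound p.1 K p.2 x := by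
  unfold gronwallBound
  split_ifs <;> fun_prop

section ApproxTrajectory

open NNReal

variable {E : Type*} [NormedAddCommGroup E] [NormedSpace ℝ E]

/-- `f` solves `ẋ = v(x)` on `[a, b]` up to an error `ε` in the derivative. The derivative is only
required off a countable set, so that piecewise differentiable curves are included. -/
def IsApproxTrajectory (v : E → E) (ε a b : ℝ) (f : ℝ → E) : Prop :=
  ContinuousOn f (Icc a b) ∧ ∃ F : Set ℝ, F.Countable ∧ ∀ t ∈ Ioo a b \ F,
    ∃ D, HasDerivAt f D t ∧ ‖D - v (f t)‖ ≤ ε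

variable [CompleteSpace E] {v : E → E} {s : Set E} {a b t ε ε' : ℝ} {f g : ℝ → E}

theorem IsApproxTrajectory.dist_le_mul {A : ℝ} (hf : IsApproxTrajectory v ε a b f)
    (hfs : MapsTo f (Icc a b) s) (hv : ∀ u ∈ s, ‖v u‖ ≤ A) (ht : t ∈ Icc a b) :
    dist (f t) (f a) ≤ (A + ε) * (t - a) := by
  obtain ⟨hfc, F, hF, hf'⟩ := hf
  rw [dist_eq_norm]
  refine norm_sub_le_mul_of_norm_deriv_le_off_countable hF hfc (fun u hu ↦ ?_) ht
  obtain ⟨D, hD, hDv⟩ := hf' u hu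
  refine ⟨D, hD, ?_⟩
  linarith [norm_le_norm_sub_add D (v (f u)), hv _ (hfs (Ioo_subset_Icc_self hu.1))]

theorem IsApproxTrajectory.dist_le_gronwallBound {K : ℝ≥0} (hf : IsApproxTrajectory v ε a b f)
    (hg : IsApproxTrajectory v ε' a b g) (hv : LipschitzOnWith K v s)
    (hfs : MapsTo f (Icc a b) s) (hgs : MapsTo g (Icc a b) s) (ht : t ∈ Icc a b) :
    dist (f t) (g t) ≤ gronwallBound (dist (f a) (g a)) K (ε + ε') (t - a) := by
  obtain ⟨hfc, F, hF, hf'⟩ := hf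
  obtain ⟨hgc, G, hG, hg'⟩ := hg
  simp only [dist_eq_norm]
  refine norm_le_gronwallBound_of_norm_deriv_le_off_countable (f := fun t ↦ f t - g t) K.2
    (hF.union hG) (hfc.sub hgc) (fun u hu ↦ ?_) ht
  obtain ⟨D, hD, hDv⟩ := hf' u ⟨hu.1, fun h ↦ hu.2 (.inl h)⟩
  obtain ⟨D', hD', hDv'⟩ := hg' u ⟨hu.1, fun h ↦ hu.2 (.inr h)⟩
  refine ⟨D - D', hD.sub hD', ?_⟩
  have hu' := Ioo_subset_Icc_self hu.1
  calc ‖D - D'‖ = ‖(v (f u) - v (g u)) + (D - v (f u)) - (D' - v (g u))‖ := by congr 1; abel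
    _ ≤ ‖v (f u) - v (g u)‖ + ‖D - v (f u)‖ + ‖D' - v (g u)‖ :=
      (norm_sub_le _ _).trans (by gcongr; exact norm_add_le _ _)
    _ ≤ K * ‖f u - g u‖ + ε + ε' := by
      gcongr
      exact hv.norm_sub_le (hfs hu') (hgs hu')
    _ = K * ‖f u - g u‖ + (ε + ε') := add_assoc _ _ _

end ApproxTrajectory

section MinimalSets

variable {X : Type*} [TopologicalSpace X] {φ : ℝ → X → X}

theorem isInvariant_orbitClosure (hadd : ∀ s t x, φ (s + t) x = φ s (φ t x))
    (hcont : ∀ t, Continuous (φ t)) (x : X) : IsInvariant φ (orbitClosure φ x) := by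
  intro t
  refine MapsTo.closure ?_ (hcont t)
  rintro _ ⟨s, rfl⟩
  exact ⟨t + s, hadd t s x⟩

theorem isInvariant_omegaLimit_atTop (hadd : ∀ s t x, φ (s + t) x = φ s (φ t x))
    (hcont : ∀ t, Continuous (φ t)) (s : Set X) : IsInvariant φ (omegaLimit atTop φ s) := by
  intro t
  refine (mapsTo_omegaLimit s ?_ (fun u x ↦ (hadd t u x).symm) (hcont t)).mono_right
    (omegaLimit_subset_of_tendsto φ s (tendsto_atTop_add_const_left atTop t tendsto_id))
  exact fun x ↦ id

theorem exists_minimal_isClosed_isInvariant [CompactSpace X] {A : Set X} (hA : A.Nonempty)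
    (hAc : IsClosed A) (hAi : IsInvariant φ A) :
    ∃ B ⊆ A, Minimal (fun B ↦ B.Nonempty ∧ IsClosed B ∧ IsInvariant φ B) B := by
  refine zorn_superset_nonempty {B : Set X | B.Nonempty ∧ IsClosed B ∧ IsInvariant φ B}
    (fun c hc hchain hne ↦ ⟨⋂₀ c, ⟨?_, ?_, ?_⟩, fun B ↦ sInter_subset_of_mem⟩) A ⟨hA, hAc, hAi⟩
  · have : Nonempty c := hne.to_subtype
    exact IsCompact.nonempty_sInter_of_directed_nonempty_isCompact_isClosed
      (IsChain.directedOn (r := fun B C : Set X ↦ B ⊇ C) hchain.symm)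
      (fun B hB ↦ (hc hB).1) (fun B hB ↦ (hc hB).2.1.isCompact)
      (fun B hB ↦ (hc hB).2.1)
  · exact isClosed_sInter fun B hB ↦ (hc hB).2.1
  · exact fun t x hx B hB ↦ (hc hB).2.2 t (hx B hB)

theorem exists_isMinimalPoint_mem [CompactSpace X] (hzero : ∀ x, φ 0 x = x)
    (hadd : ∀ s t x, φ (s + t) x = φ s (φ t x)) (hcont : ∀ t, Continuous (φ t))
    {A : Set X} (hA : A.Nonempty) (hAc : IsClosed A) (hAi : IsInvariant φ A) :
    ∃ x ∈ A, IsMinimalPoint φ x := by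
  obtain ⟨B, hBA, hB⟩ := exists_minimal_isClosed_isInvariant hA hAc hAi
  obtain ⟨⟨x, hx⟩, hBc, hBi⟩ := hB.prop
  have hsub : orbitClosure φ x ⊆ B := closure_minimal (range_subset_iff.2 fun t ↦ hBi t hx) hBc
  have horbit : orbitClosure φ x = B := hB.eq_of_subset
    ⟨⟨x, subset_closure ⟨0, hzero x⟩⟩, isClosed_closure, isInvariant_orbitClosure hadd hcont x⟩ hsub
  refine ⟨x, hBA hx, fun C hC hCn hCc hCi ↦ ?_⟩
  rw [horbit] at hC ⊢
  exact hB.eq_of_subset ⟨hCn, hCc, hCi⟩ hC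

theorem exists_nonneg_mem_of_minimalSet_subset [CompactSpace X] (hzero : ∀ x, φ 0 x = x)
    (hadd : ∀ s t x, φ (s + t) x = φ s (φ t x)) (hcont : ∀ t, Continuous (φ t))
    {U : Set X} (hU : IsOpen U) (hφU : minimalSet φ ⊆ U) (x : X) :
    ∃ t, 0 ≤ t ∧ φ t x ∈ U := by
  obtain ⟨y, hyω, hymin⟩ := exists_isMinimalPoint_mem hzero hadd hcont
    (nonempty_omegaLimit atTop φ {x} (singleton_nonempty x)) (isClosed_omegaLimit _ _ _)
    (isInvariant_omegaLimit_atTop hadd hcont {x})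
  have hfreq : ∃ᶠ t in atTop, φ t x ∈ U := by
    rw [mem_omegaLimit_singleton_iff_mapClusterPt] at hyω
    exact hyω.frequently (hU.mem_nhds (hφU (subset_closure hymin)))
  obtain ⟨t, htU, ht⟩ := (hfreq.and_eventually (eventually_ge_atTop 0)).exists
  exact ⟨t, ht, htU⟩

end MinimalSets

theorem mapsTo_Icc_of_forall_mapsTo_imp_mem {X : Type*} [TopologicalSpace X] {γ : ℝ → X}
    {a b : ℝ} {Q O : Set X} (hγ : ContinuousOn γ (Icc a b)) (hQ : IsClosed Q) (hO : IsOpen O)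
    (hQO : Q ⊆ O) (ha : γ a ∈ Q)
    (hstep : ∀ c ∈ Icc a b, MapsTo γ (Icc a c) O → γ c ∈ Q) : MapsTo γ (Icc a b) Q := by
  suffices hmaps : MapsTo γ (Icc a b) O from fun c hc ↦
    hstep c hc (hmaps.mono_left (Icc_subset_Icc_right hc.2))
  by_contra hexit
  obtain ⟨t, ht, htO⟩ : ∃ t ∈ Icc a b, γ t ∉ O := by
    simpa only [MapsTo, not_forall, exists_prop] using hexit
  have hclosed : IsClosed (Icc a b ∩ γ ⁻¹' Oᶜ) :=
    hγ.preimage_isClosed_of_isClosed isClosed_Icc hO.isClosed_compl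
  obtain ⟨c, ⟨hc, hcO⟩, hleast⟩ :=
    (isCompact_Icc.of_isClosed_subset hclosed inter_subset_left).exists_isLeast
      ⟨t, ht, htO⟩
  have hbefore : ∀ t ∈ Ico a c, γ t ∈ O := fun t ht ↦ by
    by_contra h
    exact (hleast ⟨⟨ht.1, ht.2.le.trans hc.2⟩, h⟩).not_gt ht.2
  have hac : a < c := hc.1.lt_of_ne fun h ↦ hcO (hQO (h ▸ ha))
  have hcQ : γ c ∈ closure Q := by
    refine ContinuousWithinAt.mem_closure (s := Ico a c)
      ((hγ c hc).mono (Ico_subset_Icc_self.trans (Icc_subset_Icc_right hc.2))) ?_ fun t ht ↦ ?_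
    · rw [closure_Ico hac.ne]
      exact right_mem_Icc.2 hac.le
    · exact hstep t ⟨ht.1, ht.2.le.trans hc.2⟩ fun u hu ↦ hbefore u ⟨hu.1, hu.2.trans_lt ht.2⟩
  exact hcO (hQO (hQ.closure_eq ▸ hcQ))

section WeakDeltaSolutions

theorem exists_mem_Ioo_succ_of_notMem_range {α : Type*} [LinearOrder α] {τ : ℕ → α} {t : α}
    (ht : t ∉ range τ) (h₀ : τ 0 < t) {n : ℕ} (hn : t < τ n) :
    ∃ i < n, t ∈ Ioo (τ i) (τ (i + 1)) := by
  induction n with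
  | zero => exact absurd hn h₀.not_gt
  | succ n ih =>
    rcases lt_trichotomy t (τ n) with hlt | heq | hgt
    · obtain ⟨i, hi, hti⟩ := ih hlt
      exact ⟨i, hi.trans n.lt_succ_self, hti⟩
    · exact absurd ⟨n, heq.symm⟩ ht
    · exact ⟨n, n.lt_succ_self, hgt, hn⟩

variable {E : Type*} [NormedAddCommGroup E] [NormedSpace ℝ E]
  {H : Type*} [TopologicalSpace H] {I : ModelWithCorners ℝ E H}
  {M : Type*} [TopologicalSpace M] [ChartedSpace H M]
  [RiemannianBundle (fun x : M ↦ TangentSpace I x)]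

/-- A continuous curve on `[a, b]` which, off a countable set, is differentiable and satisfies
`|γ'(t) - V(γ(t))| ≤ δ`. Unlike `IsDeltaSolution`, this condition restricts to subintervals, as no
one-sided derivative is involved. -/
def IsWeakDeltaSolution (V : (x : M) → TangentSpace I x) (δ a b : ℝ) (γ : ℝ → M) : Prop :=
  ContinuousOn γ (Icc a b) ∧ ∃ F : Set ℝ, F.Countable ∧ ∀ t ∈ Ioo a b \ F,
    MDifferentiableAt 𝓘(ℝ, ℝ) I γ t ∧
      ‖(mfderiv 𝓘(ℝ, ℝ) I γ t (1 : ℝ) : TangentSpace I (γ t)) - V (γ t)‖ ≤ δ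

variable {V : (x : M) → TangentSpace I x} {δ δ' a b a' b' : ℝ} {γ : ℝ → M}

theorem IsWeakDeltaSolution.mono (h : IsWeakDeltaSolution V δ a b γ) (hδ : δ ≤ δ') (ha : a ≤ a')
    (hb : b' ≤ b) : IsWeakDeltaSolution V δ' a' b' γ := by
  obtain ⟨hc, F, hF, hd⟩ := h
  refine ⟨hc.mono (Icc_subset_Icc ha hb), F, hF, fun t ht ↦ ?_⟩
  exact (hd t ⟨Ioo_subset_Ioo ha hb ht.1, ht.2⟩).imp_right hδ.trans'

theorem IsDeltaSolution.isWeakDeltaSolution (h : IsDeltaSolution V δ a b γ) :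
    IsWeakDeltaSolution V δ a b γ := by
  obtain ⟨-, ⟨hc, n, τ, -, rfl, rfl, hC1⟩, hd⟩ := h
  refine ⟨hc, range τ, countable_range τ, fun t ⟨ht, htτ⟩ ↦ ?_⟩
  obtain ⟨i, hi, hti⟩ := exists_mem_Ioo_succ_of_notMem_range htτ ht.1 ht.2
  have hdiff : MDifferentiableAt 𝓘(ℝ, ℝ) I γ t :=
    ((hC1 i hi).contMDiffAt (Icc_mem_nhds hti.1 hti.2)).mdifferentiableAt one_ne_zero
  have hle := hd t (Ioo_subset_Icc_self ht) hdiff.mdifferentiableWithinAt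
  rw [mfderivWithin_of_mem_nhds (Icc_mem_nhds ht.1 ht.2)] at hle
  exact ⟨hdiff, hle⟩

theorem isWeakDeltaSolution_of_isMIntegralCurve (h : IsMIntegralCurve γ V) (a b : ℝ) :
    IsWeakDeltaSolution V 0 a b γ := by
  refine ⟨h.continuous.continuousOn, ∅, countable_empty, fun t _ ↦
    ⟨(h t).mdifferentiableAt, ?_⟩⟩
  have hspeed : mfderiv 𝓘(ℝ, ℝ) I γ t (1 : ℝ) = V (γ t) := by
    rw [(h t).mfderiv]
    exact one_smul ℝ (V (γ t))
  rw [hspeed, sub_self, norm_zero]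

end WeakDeltaSolutions

section ChartVectorField

open NNReal

variable {E : Type*} [NormedAddCommGroup E] [NormedSpace ℝ E]
  {H : Type*} [TopologicalSpace H] {I : ModelWithCorners ℝ E H}
  {M : Type*} [TopologicalSpace M] [ChartedSpace H M]

/-- The expression of the vector field `V` in the preferred chart at `x₀`, a vector field on the
model space `E`; its values outside the target of the chart are irrelevant. -/
noncomputable def chartVectorField (V : (x : M) → TangentSpace I x) (x₀ : M) (u : E) : E :=
  mfderiv I 𝓘(ℝ, E) (extChartAt I x₀) ((extChartAt I x₀).symm u) (V ((extChartAt I x₀).symm u))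

variable [IsManifold I 1 M] {V : (x : M) → TangentSpace I x} {x₀ : M}

theorem mfderiv_extChartAt_eq_tangentCoordChange {p : M} (hp : p ∈ (extChartAt I x₀).source) :
    mfderiv I 𝓘(ℝ, E) (extChartAt I x₀) p = tangentCoordChange I p x₀ p := by
  rw [extChartAt_source] at hp
  rw [(hasMFDerivAt_extChartAt hp).mfderiv, mfderiv_chartAt_eq_tangentCoordChange hp]

theorem contDiffAt_chartVectorField [BoundarylessManifold I M]
    (hV : ContMDiffAt I I.tangent 1 (fun x ↦ (⟨x, V x⟩ : TangentBundle I M)) x₀) :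
    ContDiffAt ℝ 1 (chartVectorField V x₀) (extChartAt I x₀ x₀) := by
  have hx₀ : I.IsInteriorPoint x₀ := BoundarylessManifold.isInteriorPoint
  have htarget : (extChartAt I x₀).target ∈ 𝓝 (extChartAt I x₀ x₀) :=
    mem_interior_iff_mem_nhds.1 (ModelWithCorners.isInteriorPoint_iff.1 hx₀)
  have hcoord : ContDiffAt ℝ 1 (fun u ↦ tangentCoordChange I ((extChartAt I x₀).symm u) x₀
      ((extChartAt I x₀).symm u) (V ((extChartAt I x₀).symm u))) (extChartAt I x₀ x₀) :=
    ((contMDiffAt_iff.1 hV).2.contDiffAt (range_mem_nhds_isInteriorPoint hx₀)).snd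
  refine hcoord.congr_of_eventuallyEq ?_
  filter_upwards [htarget] with u hu
  exact DFunLike.congr_fun
    (mfderiv_extChartAt_eq_tangentCoordChange ((extChartAt I x₀).map_target hu)) _

theorem hasDerivAt_extChartAt_comp {γ : ℝ → M} {t : ℝ}
    (hγ : MDifferentiableAt 𝓘(ℝ, ℝ) I γ t) (ht : γ t ∈ (extChartAt I x₀).source) :
    HasDerivAt (extChartAt I x₀ ∘ γ)
      (mfderiv I 𝓘(ℝ, E) (extChartAt I x₀) (γ t) (mfderiv 𝓘(ℝ, ℝ) I γ t (1 : ℝ)) : E) t := by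
  rw [extChartAt_source] at ht
  let L : E →L[ℝ] E := mfderiv I 𝓘(ℝ, E) (extChartAt I x₀) (γ t)
  let L' : ℝ →L[ℝ] E := mfderiv 𝓘(ℝ, ℝ) I γ t
  have hcomp : HasFDerivAt (extChartAt I x₀ ∘ γ) (L ∘L L') t :=
    hasMFDerivAt_iff_hasFDerivAt.1
      ((hasMFDerivAt_extChartAt ht).mdifferentiableAt.hasMFDerivAt.comp t hγ.hasMFDerivAt)
  exact hcomp.hasDerivAt

variable [RiemannianBundle (fun x : M ↦ TangentSpace I x)]

theorem IsWeakDeltaSolution.isApproxTrajectory {C : ℝ≥0} {δ a b : ℝ} {γ : ℝ → M}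
    (hγ : IsWeakDeltaSolution V δ a b γ) (hsource : MapsTo γ (Icc a b) (extChartAt I x₀).source)
    (hC : ∀ t ∈ Icc a b, ∀ w : TangentSpace I (γ t),
      @norm E _ (mfderiv I 𝓘(ℝ, E) (extChartAt I x₀) (γ t) w) ≤ C * ‖w‖) :
    IsApproxTrajectory (chartVectorField V x₀) (C * δ) a b (extChartAt I x₀ ∘ γ) := by
  obtain ⟨hc, F, hF, hd⟩ := hγ
  refine ⟨(continuousOn_extChartAt x₀).comp hc hsource, F, hF, fun t ht ↦ ?_⟩
  obtain ⟨hdiff, hle⟩ := hd t ht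
  have htI := Ioo_subset_Icc_self ht.1
  refine ⟨_, hasDerivAt_extChartAt_comp hdiff (hsource htI), ?_⟩
  rw [chartVectorField, Function.comp_apply, (extChartAt I x₀).left_inv (hsource htI)]
  have hbound := hC t htI (mfderiv 𝓘(ℝ, ℝ) I γ t (1 : ℝ) - V (γ t))
  rw [map_sub] at hbound
  exact hbound.trans (by gcongr)

variable [IsContinuousRiemannianBundle E (fun x : M ↦ TangentSpace I x)]

theorem exists_eventually_norm_mfderiv_extChartAt_apply_le (x₀ : M) :
    ∃ C : ℝ≥0, ∀ᶠ p in 𝓝 x₀, ∀ w : TangentSpace I p,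
      @norm E _ (mfderiv I 𝓘(ℝ, E) (extChartAt I x₀) p w) ≤ C * ‖w‖ := by
  obtain ⟨C, hC, h⟩ := eventually_norm_mfderiv_extChartAt_lt I x₀
  refine ⟨⟨C, hC.le⟩, h.mono fun p hp w ↦ ?_⟩
  let := normedAddCommGroupTangentSpaceVectorSpace (E := E)
  let := normedSpaceTangentSpaceVectorSpace (E := E)
  exact ContinuousLinearMap.le_of_opNorm_le _ hp.le w

theorem exists_nhds_chartVectorField_estimates [BoundarylessManifold I M]
    (hV : ContMDiffAt I I.tangent 1 (fun x ↦ (⟨x, V x⟩ : TangentBundle I M)) x₀) :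
    ∃ K A C : ℝ≥0, ∃ O ∈ 𝓝 x₀, O ⊆ (extChartAt I x₀).source ∧
      LipschitzOnWith K (chartVectorField V x₀) (extChartAt I x₀ '' O) ∧
      (∀ u ∈ extChartAt I x₀ '' O, ‖chartVectorField V x₀ u‖ ≤ A) ∧
      ∀ δ a b γ, IsWeakDeltaSolution V δ a b γ → MapsTo γ (Icc a b) O →
        IsApproxTrajectory (chartVectorField V x₀) (C * δ) a b (extChartAt I x₀ ∘ γ) := by
  have hv := contDiffAt_chartVectorField hV
  obtain ⟨K, S, hS, hlip⟩ := hv.exists_lipschitzOnWith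
  obtain ⟨C, hC⟩ := exists_eventually_norm_mfderiv_extChartAt_apply_le (I := I) x₀
  let A : ℝ≥0 := ‖chartVectorField V x₀ (extChartAt I x₀ x₀)‖₊ + 1
  have hA : ∀ᶠ u in 𝓝 (extChartAt I x₀ x₀), ‖chartVectorField V x₀ u‖ ≤ A :=
    hv.continuousAt.norm.eventually_le_const (lt_add_one _)
  have hchart := continuousAt_extChartAt (I := I) x₀
  refine ⟨K, A, C, _, inter_mem (inter_mem (extChartAt_source_mem_nhds x₀) hC)
    (hchart (inter_mem hS hA)), fun p hp ↦ hp.1.1,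
    hlip.mono (image_subset_iff.2 fun p hp ↦ hp.2.1), ?_, fun δ a b γ hγ hO ↦ ?_⟩
  · rintro _ ⟨p, hp, rfl⟩
    exact hp.2.2
  · exact hγ.isApproxTrajectory (fun t ht ↦ (hO ht).1.1) fun t ht ↦ (hO ht).1.2

end ChartVectorField

section Flow

open NNReal

variable {E : Type*} [NormedAddCommGroup E] [NormedSpace ℝ E] [CompleteSpace E]
  {H : Type*} [TopologicalSpace H] {I : ModelWithCorners ℝ E H}
  {M : Type*} [TopologicalSpace M] [ChartedSpace H M] [IsManifold I 1 M]
  [BoundarylessManifold I M]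
  {V : (x : M) → TangentSpace I x}

theorem flowOf_add [T2Space M] [CompactSpace M]
    (hV : ContMDiff I I.tangent 1 (fun x ↦ (⟨x, V x⟩ : TangentBundle I M)))
    (s t : ℝ) (x : M) : flowOf hV (s + t) x = flowOf hV s (flowOf hV t x) := by
  simpa using eq_flowOf hV ((isMIntegralCurve_flowOf hV x).comp_add t) s

variable [RiemannianBundle (fun x : M ↦ TangentSpace I x)]

theorem eventually_forall_isWeakDeltaSolution_mapsTo [RegularSpace M]
    [IsContinuousRiemannianBundle E (fun x : M ↦ TangentSpace I x)] {x₀ : M}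
    (hV : ContMDiffAt I I.tangent 1 (fun x ↦ (⟨x, V x⟩ : TangentBundle I M)) x₀)
    {O : Set M} (hO : O ∈ 𝓝 x₀) (δ : ℝ≥0) :
    ∀ᶠ p : ℝ × M in 𝓝 (0, x₀), ∀ a b γ, b - a ≤ p.1 → IsWeakDeltaSolution V δ a b γ →
      γ a = p.2 → MapsTo γ (Icc a b) O := by
  obtain ⟨-, A, C, O', hO', hsource, -, hA, happrox⟩ := exists_nhds_chartVectorField_estimates hV
  obtain ⟨Q, ⟨hQ, hQc⟩, hQO⟩ := (closed_nhds_basis x₀).mem_iff.1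
    (interior_mem_nhds.2 (inter_mem hO hO'))
  have hO'O : interior (O ∩ O') ⊆ O' := interior_subset.trans inter_subset_right
  let e := extChartAt I x₀
  have hQe : e.symm ⁻¹' Q ∈ 𝓝 (e x₀) := by
    refine (continuousAt_extChartAt_symm x₀).preimage_mem_nhds ?_
    rwa [extChartAt_to_inv x₀]
  obtain ⟨r, hr, hball⟩ := Metric.mem_nhds_iff.1 hQe
  have hsmall : ∀ᶠ p : ℝ × M in 𝓝 (0, x₀), (A + C * δ) * p.1 + dist (e p.2) (e x₀) < r := by
    have he : ContinuousAt (fun p : ℝ × M ↦ e p.2) (0, x₀) :=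
      ContinuousAt.comp (continuousAt_extChartAt x₀) continuousAt_snd
    exact ((continuousAt_fst.const_mul _).add (he.dist continuousAt_const)).eventually_lt_const
      (by simpa using hr)
  filter_upwards [hsmall, continuousAt_snd.preimage_mem_nhds hQ]
    with ⟨τ, y⟩ hr' hyQ a b γ hab hγ hγa
  refine (mapsTo_Icc_of_forall_mapsTo_imp_mem hγ.1 hQc isOpen_interior hQO (hγa ▸ hyQ)
    fun c hc hcO ↦ ?_).mono_right (hQO.trans (interior_subset.trans inter_subset_left))
  have htraj := happrox δ a c γ (hγ.mono le_rfl le_rfl hc.2) (hcO.mono_right hO'O)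
  have hspeed : dist (e (γ c)) (e (γ a)) ≤ (A + C * δ) * (c - a) :=
    htraj.dist_le_mul (fun t ht ↦ mem_image_of_mem e (hO'O (hcO ht))) hA (right_mem_Icc.2 hc.1)
  have hτ : (A + C * δ : ℝ) * (c - a) ≤ (A + C * δ) * τ := by
    gcongr
    linarith [hc.2]
  have hmem : e.symm (e (γ c)) ∈ Q := hball <| Metric.mem_ball.2 <| by
    linarith [dist_triangle (e (γ c)) (e (γ a)) (e x₀), hγa ▸ hr']
  rwa [e.left_inv (hsource (hO'O (hcO (right_mem_Icc.2 hc.1))))] at hmem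

variable [T2Space M] [CompactSpace M]

theorem isWeakDeltaSolution_flowOf_sub
    (hV : ContMDiff I I.tangent 1 (fun x ↦ (⟨x, V x⟩ : TangentBundle I M))) (x : M) (a b : ℝ) :
    IsWeakDeltaSolution V 0 a b fun t ↦ flowOf hV (t - a) x :=
  isWeakDeltaSolution_of_isMIntegralCurve
    (isMIntegralCurve_comp_sub.2 (isMIntegralCurve_flowOf hV x)) a b

/-- Weak `δ`-solutions that start near `y` are near `flowOf hV s y` after time `s`, for all small
`δ`. The starting time `a` is arbitrary, so that this property can be chained without translating
curves. -/
def IsShadowedAt (hV : ContMDiff I I.tangent 1 (fun x ↦ (⟨x, V x⟩ : TangentBundle I M)))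
    (s : ℝ) (y : M) : Prop :=
  ∀ U ∈ 𝓝 (flowOf hV s y), ∀ᶠ p : M × ℝ in 𝓝 (y, 0), ∀ a γ,
    IsWeakDeltaSolution V p.2 a (a + s) γ → γ a = p.1 → γ (a + s) ∈ U

theorem IsShadowedAt.add
    {hV : ContMDiff I I.tangent 1 (fun x ↦ (⟨x, V x⟩ : TangentBundle I M))} {s t : ℝ} {y : M}
    (hs : 0 ≤ s) (ht : 0 ≤ t) (h : IsShadowedAt hV s y) (h' : IsShadowedAt hV t (flowOf hV s y)) :
    IsShadowedAt hV (s + t) y := by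
  intro U hU
  rw [add_comm, flowOf_add] at hU
  obtain ⟨N, hN, D, hD, hND⟩ := mem_nhds_prod_iff.1 (h' U hU)
  filter_upwards [h N hN, continuousAt_snd.preimage_mem_nhds hD] with ⟨x, δ⟩ hx hδ a γ hγ hγa
  have hmid : γ (a + s) ∈ N := hx a γ (hγ.mono le_rfl le_rfl (by linarith)) hγa
  rw [← add_assoc] at hγ ⊢
  exact hND (mk_mem_prod hmid hδ) (a + s) γ (hγ.mono le_rfl (by linarith) le_rfl) rfl

theorem isShadowedAt_of_eventually_mapsTo
    {hV : ContMDiff I I.tangent 1 (fun x ↦ (⟨x, V x⟩ : TangentBundle I M))} {x₀ : M} {O : Set M}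
    {K C : ℝ≥0} (hsource : O ⊆ (extChartAt I x₀).source)
    (hlip : LipschitzOnWith K (chartVectorField V x₀) (extChartAt I x₀ '' O))
    (happrox : ∀ δ a b γ, IsWeakDeltaSolution V δ a b γ → MapsTo γ (Icc a b) O →
      IsApproxTrajectory (chartVectorField V x₀) (C * δ) a b (extChartAt I x₀ ∘ γ))
    {s : ℝ} (hs : 0 ≤ s) {y : M}
    (hstay : ∀ᶠ x in 𝓝 y, ∀ a γ, IsWeakDeltaSolution V 1 a (a + s) γ → γ a = x →
      MapsTo γ (Icc a (a + s)) O) : IsShadowedAt hV s y := by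
  intro U hU
  let e := extChartAt I x₀
  have hflow : ∀ a, MapsTo (fun t ↦ flowOf hV (t - a) y) (Icc a (a + s)) O := fun a ↦
    hstay.self_of_nhds a _
      ((isWeakDeltaSolution_flowOf_sub hV y a _).mono zero_le_one le_rfl le_rfl)
      (by simp only [sub_self, flowOf_zero])
  have hyO : y ∈ O := by simpa [flowOf_zero] using hflow 0 (x := 0) (by simp [hs])
  have hsO : flowOf hV s y ∈ O := by simpa using hflow 0 (x := s) (by simp [hs])
  have hUe : e.symm ⁻¹' U ∈ 𝓝 (e (flowOf hV s y)) := by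
    refine (continuousAt_extChartAt_symm' (hsource hsO)).preimage_mem_nhds ?_
    rwa [e.left_inv (hsource hsO)]
  obtain ⟨ρ, hρ, hball⟩ := Metric.mem_nhds_iff.1 hUe
  have hgronwall : ∀ᶠ p : M × ℝ in 𝓝 (y, 0),
      gronwallBound (dist (e p.1) (e y)) K (C * p.2) s < ρ := by
    have he : ContinuousAt (fun p : M × ℝ ↦ e p.1) (y, 0) :=
      ContinuousAt.comp (continuousAt_extChartAt' (hsource hyO)) continuousAt_fst
    have hcont : ContinuousAt (fun p : M × ℝ ↦ (dist (e p.1) (e y), C * p.2)) (y, 0) :=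
      ContinuousAt.prodMk (he.dist continuousAt_const) (continuousAt_snd.const_mul _)
    exact ((continuous_gronwallBound K s).continuousAt.comp hcont).eventually_lt_const
      (by simpa [gronwallBound_ε0_δ0] using hρ)
  filter_upwards [hgronwall, continuousAt_fst.eventually hstay,
    continuousAt_snd.eventually_le_const zero_lt_one] with ⟨x, δ⟩ hlt hstay_x hδ a γ hγ hγa
  have hγO : MapsTo γ (Icc a (a + s)) O := hstay_x a γ (hγ.mono hδ le_rfl le_rfl) hγa
  have hend : a + s ∈ Icc a (a + s) := right_mem_Icc.2 (le_add_of_nonneg_right hs)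
  have hdist := (happrox δ a _ γ hγ hγO).dist_le_gronwallBound
    (happrox 0 a _ _ (isWeakDeltaSolution_flowOf_sub hV y a _) (hflow a)) hlip
    (fun t ht ↦ mem_image_of_mem e (hγO ht)) (fun t ht ↦ mem_image_of_mem e (hflow a ht)) hend
  simp only [Function.comp_apply, hγa, sub_self, flowOf_zero, mul_zero, add_zero,
    add_sub_cancel_left] at hdist
  have hmem : e.symm (e (γ (a + s))) ∈ U := hball (hdist.trans_lt hlt)
  rwa [e.left_inv (hsource (hγO hend))] at hmem

variable [IsContinuousRiemannianBundle E (fun x : M ↦ TangentSpace I x)]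
  (hV : ContMDiff I I.tangent 1 (fun x ↦ (⟨x, V x⟩ : TangentBundle I M)))

theorem eventually_forall_isShadowedAt (x₀ : M) :
    ∀ᶠ p : ℝ × M in 𝓝 (0, x₀), ∀ s ∈ Icc 0 p.1, IsShadowedAt hV s p.2 := by
  obtain ⟨K, -, C, O, hO, hsource, hlip, -, happrox⟩ :=
    exists_nhds_chartVectorField_estimates (hV.contMDiffAt (x := x₀))
  filter_upwards [(eventually_forall_isWeakDeltaSolution_mapsTo
    (hV.contMDiffAt (x := x₀)) hO 1).eventually_nhds] with ⟨τ, y⟩ hstay s hs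
  refine isShadowedAt_of_eventually_mapsTo hsource hlip happrox hs.1 ?_
  filter_upwards [(Continuous.prodMk_right τ).continuousAt.eventually hstay] with x hx a γ hγ hγa
  exact hx a _ γ (by simpa using hs.2) hγ hγa

theorem exists_pos_forall_isShadowedAt :
    ∃ τ > 0, ∀ s ∈ Icc 0 τ, ∀ y, IsShadowedAt hV s y := by
  have hsmall : ∀ᶠ τ in 𝓝 (0 : ℝ), ∀ y ∈ univ, ∀ s ∈ Icc 0 τ, IsShadowedAt hV s y :=
    isCompact_univ.eventually_forall_of_forall_eventually
      fun x₀ _ ↦ eventually_forall_isShadowedAt hV x₀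
  obtain ⟨τ, hτ, hτ0⟩ := ((hsmall.filter_mono nhdsWithin_le_nhds).and
    (self_mem_nhdsWithin (s := Ioi 0))).exists
  exact ⟨τ, hτ0, fun s hs y ↦ hτ y (mem_univ y) s hs⟩

theorem isShadowedAt {s : ℝ} (hs : 0 ≤ s) (y : M) : IsShadowedAt hV s y := by
  obtain ⟨τ, hτ, hshort⟩ := exists_pos_forall_isShadowedAt hV
  have hmul : ∀ u ∈ Icc 0 τ, ∀ n : ℕ, ∀ y, IsShadowedAt hV (n * u) y := by
    intro u hu n
    induction n with
    | zero => simpa using hshort 0 (left_mem_Icc.2 hτ.le)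
    | succ n ih =>
      intro y
      rw [Nat.cast_succ, add_one_mul]
      exact (ih y).add (mul_nonneg n.cast_nonneg hu.1) hu.1 (hshort u hu _)
  obtain ⟨n, hn⟩ := exists_nat_gt (s / τ)
  have hn0 : (0 : ℝ) < n := (div_nonneg hs hτ.le).trans_lt hn
  rw [← mul_div_cancel₀ s hn0.ne']
  refine hmul (s / n) ⟨by positivity, ?_⟩ n y
  rw [div_lt_iff₀ hτ] at hn
  rw [div_le_iff₀ hn0, mul_comm]
  exact hn.le

theorem continuous_flowOf (t : ℝ) : Continuous (flowOf hV t) := by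
  have hnonneg : ∀ s, 0 ≤ s → Continuous (flowOf hV s) := by
    refine fun s hs ↦ continuous_iff_continuousAt.2 fun y U hU ↦ ?_
    rw [mem_map]
    filter_upwards [(Continuous.prodMk_left (0 : ℝ)).continuousAt.eventually
      (isShadowedAt hV hs y U hU)] with x hx
    simpa using hx 0 _ (isWeakDeltaSolution_flowOf_sub hV x 0 _) (by simp [flowOf_zero])
  rcases le_total 0 t with ht | ht
  · exact hnonneg t ht
  · let Φ : M ≃ M :=
      { toFun := flowOf hV (-t)
        invFun := flowOf hV t
        left_inv := fun x ↦ by rw [← flowOf_add, add_neg_cancel, flowOf_zero]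
        right_inv := fun x ↦ by rw [← flowOf_add, neg_add_cancel, flowOf_zero] }
    exact (Continuous.homeoOfEquivCompactToT2 (f := Φ)
      (hnonneg (-t) (neg_nonneg.2 ht))).continuous_invFun

theorem eventually_forall_image_Icc_inter_nonempty {U : Set M} (hU : IsOpen U) {s : ℝ}
    (hs : 0 ≤ s) {y : M} (hsU : flowOf hV s y ∈ U) :
    ∀ᶠ p : (ℝ × ℝ) × M in (𝓝[>] 0 ×ˢ atTop) ×ˢ 𝓝 y, ∀ x : ℝ → M,
      IsWeakDeltaSolution V p.1.1 0 p.1.2 x → x 0 = p.2 →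
        (x '' Icc 0 p.1.2 ∩ U).Nonempty := by
  have hproj : Tendsto (fun p : (ℝ × ℝ) × M ↦ (p.2, p.1.1)) ((𝓝[>] 0 ×ˢ atTop) ×ˢ 𝓝 y)
      (𝓝 (y, 0)) := by
    rw [nhds_prod_eq]
    exact tendsto_snd.prodMk (tendsto_nhds_of_tendsto_nhdsWithin (tendsto_fst.comp tendsto_fst))
  filter_upwards [hproj.eventually (isShadowedAt hV hs y U (hU.mem_nhds hsU)),
    (tendsto_snd.comp tendsto_fst).eventually (eventually_ge_atTop s)]
    with ⟨⟨δ, T⟩, z⟩ hshadow hsT x hx hx0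
  have hxs : x (0 + s) ∈ U :=
    hshadow 0 x (hx.mono le_rfl le_rfl (by rwa [zero_add])) hx0
  rw [zero_add] at hxs
  exact ⟨x s, mem_image_of_mem x ⟨hs, hsT⟩, hxs⟩

theorem mainTheorem8_general {U : Set M} (hU : IsOpen U) (hVU : minimalSet (flowOf hV) ⊆ U) :
    ∃ δ : ℝ, 0 < δ ∧ ∃ T : ℝ, 0 < T ∧ ∀ x : ℝ → M, IsWeakDeltaSolution V δ 0 T x →
      (x '' Icc 0 T ∩ U).Nonempty := by
  have hlocal : ∀ y ∈ univ, ∀ᶠ p : (ℝ × ℝ) × M in (𝓝[>] 0 ×ˢ atTop) ×ˢ 𝓝 y, ∀ x : ℝ → M,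
      IsWeakDeltaSolution V p.1.1 0 p.1.2 x → x 0 = p.2 →
        (x '' Icc 0 p.1.2 ∩ U).Nonempty := by
    intro y _
    obtain ⟨s, hs, hsU⟩ := exists_nonneg_mem_of_minimalSet_subset (flowOf_zero hV) (flowOf_add hV)
      (continuous_flowOf hV) hU hVU y
    exact eventually_forall_image_Icc_inter_nonempty hV hU hs hsU
  have hglobal := isCompact_univ.mem_prod_nhdsSet_of_forall hlocal
  rw [nhdsSet_univ, mem_prod_top] at hglobal
  have hpos : ∀ᶠ p : ℝ × ℝ in 𝓝[>] 0 ×ˢ atTop, 0 < p.1 ∧ 0 < p.2 :=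
    prod_mem_prod self_mem_nhdsWithin (eventually_gt_atTop 0)
  obtain ⟨⟨δ, T⟩, ⟨hδ, hT⟩, hmeets⟩ := (hpos.and hglobal).exists
  exact ⟨δ, hδ, T, hT, fun x hx ↦ hmeets (x 0) x hx rfl⟩

end Flow

theorem mainTheorem8 {d : ℕ}
    {M : Type*} [EMetricSpace M] [ChartedSpace (EuclideanSpace ℝ (Fin d)) M]
    [IsManifold (𝓡 d) 1 M] [CompactSpace M] [ConnectedSpace M]
    [RiemannianBundle (fun x : M ↦ TangentSpace (𝓡 d) x)]
    [IsContinuousRiemannianBundle (EuclideanSpace ℝ (Fin d))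
      (fun x : M ↦ TangentSpace (𝓡 d) x)]
    [IsRiemannianManifold (𝓡 d) M]
    (V : (x : M) → TangentSpace (𝓡 d) x)
    (hV : ContMDiff (𝓡 d) (𝓡 d).tangent 1
      (fun x ↦ (⟨x, V x⟩ : TangentBundle (𝓡 d) M))) :
    ∀ ε : ℝ, 0 < ε → ∃ δ : ℝ, 0 < δ ∧ ∃ T : ℝ, 0 < T ∧
      ∀ x : ℝ → M, IsDeltaSolution V δ 0 T x →
        (x '' Icc 0 T ∩ Metric.thickening ε (minimalSet (flowOf hV))).Nonempty := by
  intro ε hε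
  obtain ⟨δ, hδ, T, hT, h⟩ := mainTheorem8_general hV Metric.isOpen_thickening
    (Metric.self_subset_thickening hε (minimalSet (flowOf hV)))
  exact ⟨δ, hδ, T, hT, fun x hx ↦ h x hx.isWeakDeltaSolution⟩
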